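/- Let $0<\alpha<1$. For $f:\mathbb{R}\to\mathbb{R}$ and $\sigma>0$ define the left ($-$) and right ($+$) Liouville fractional integrals $${}^{-}I^{\sigma}f(x)=\frac{1}{\Gamma(\sigma)}\int_{-\infty}^{x}\frac{f(y)}{(x-y)^{1-\sigma}}\,dy,\qquad {}^{+}I^{\sigma}f(x)=\frac{1}{\Gamma(\sigma)}\int_{x}^{\infty}\frac{f(y)}{(y-x)^{1-\sigma}}\,dy,$$ and the classical left and right fractional derivatives $${}^{-}D^{\alpha}f=\frac{d}{dx}\,{}^{-}I^{1-\alpha}f,\qquad {}^{+}D^{\alpha}f=-\frac{d}{dx}\,{}^{+}I^{1-\alpha}f .$$ For $u\in L^1(\mathbb{R})$, a function $v\in L^1_{loc}(\mathbb{R})$ is the left weak fractional derivative ${}^{-}\mathcal{D}^{\alpha}u$ (respectively the right weak fractional derivative ${}^{+}\mathcal{D}^{\alpha}u$) of $u$ if $\int_{\mathbb{R}}v\varphi\,dx=\int_{\mathbb{R}}u\;{}^{+}D^{\alpha}\varphi\,dx$ (respectively $\int_{\mathbb{R}}v\varphi\,dx=\int_{\mathbb{R}}u\;{}^{-}D^{\alpha}\varphi\,dx$)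 for all $\varphi\in C_0^\infty(\mathbb{R})$; it is determined up to a null set. **Theorem (Fundamental Theorem of Weak Fractional Calculus on $\mathbb{R}$).** Let $0<\alpha<1$ and let $u,v\in L^{1}(\mathbb{R})$ be real-valued. For each choice of sign $\pm$: 1. If $u={}^{\pm}I^{\alpha}v$ almost everywhere in $\mathbb{R}$, then ${}^{\pm}\mathcal{D}^{\alpha}u$ exists and equals $v$ almost everywhere. 2. Conversely, if ${}^{\pm}\mathcal{D}^{\alpha}u=v$ almost everywhere and if $u(x)\to0$ almost everywhere as $|x|\to\infty$ (for every $\varepsilon>0$ there is $R$ such that $|u(x)|<\varepsilon$ for almost every $x$ with $|x|\ge R$), then for almost every $x\in\mathbb{R}$ the integral defining ${}^{\pm}I^{\alpha}v(x)$ converges absolutely and $u(x)={}^{\pm}I^{\alpha}v(x)$. -/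

import Mathlib

open scoped ContDiff

/-- Left Liouville fractional integral of order `σ` on the real line,
`(1 / Γ(σ)) ∫_{-∞}^x f(y) (x - y)^{σ - 1} dy`. -/
noncomputable def leftFracInt (σ : ℝ) (f : ℝ → ℝ) (x : ℝ) : ℝ :=
  1 / Real.Gamma σ * ∫ y in Set.Iio x, f y / (x - y) ^ (1 - σ)

/-- Right Liouville fractional integral of order `σ` on the real line,
`(1 / Γ(σ)) ∫_x^∞ f(y) (y - x)^{σ - 1} dy`. -/
noncomputable def rightFracInt (σ : ℝ) (f : ℝ → ℝ) (x : ℝ) : ℝ :=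
  1 / Real.Gamma σ * ∫ y in Set.Ioi x, f y / (y - x) ^ (1 - σ)

/-- Left classical (Liouville) fractional derivative of order `0 < α < 1` on the real line:
the first derivative of the left fractional integral of order `1 - α`. -/
noncomputable def leftFracDeriv (α : ℝ) (f : ℝ → ℝ) (x : ℝ) : ℝ :=
  deriv (leftFracInt (1 - α) f) x

/-- Right classical (Liouville) fractional derivative of order `0 < α < 1` on the real line:
minus the first derivative of the right fractional integral of order `1 - α`. -/
noncomputable def rightFracDeriv (α : ℝ) (f : ℝ → ℝ) (x : ℝ) : ℝ :=
  -deriv (rightFracInt (1 - α) f) x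

/-- For `u ∈ L¹(ℝ)` and `0 < α < 1`, the function `v ∈ L¹_loc(ℝ)` is (a representative of) the
left weak fractional derivative of `u` of order `α`: testing against the right classical
fractional derivative of every smooth compactly supported function. The sign `(-1)^[α]` is `1`,
because `[α] = 0`. -/
structure IsLeftWeakFracDeriv (α : ℝ) (u v : ℝ → ℝ) : Prop where
  integrable : MeasureTheory.Integrable u MeasureTheory.volume
  locallyIntegrable : MeasureTheory.LocallyIntegrable v MeasureTheory.volume
  integral_eq : ∀ φ : ℝ → ℝ, ContDiff ℝ ∞ φ → HasCompactSupport φ →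
    ∫ x, v x * φ x = ∫ x, u x * rightFracDeriv α φ x

/-- For `u ∈ L¹(ℝ)` and `0 < α < 1`, the function `v ∈ L¹_loc(ℝ)` is (a representative of) the
right weak fractional derivative of `u` of order `α`: testing against the left classical
fractional derivative of every smooth compactly supported function. -/
structure IsRightWeakFracDeriv (α : ℝ) (u v : ℝ → ℝ) : Prop where
  integrable : MeasureTheory.Integrable u MeasureTheory.volume
  locallyIntegrable : MeasureTheory.LocallyIntegrable v MeasureTheory.volume
  integral_eq : ∀ φ : ℝ → ℝ, ContDiff ℝ ∞ φ → HasCompactSupport φ →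
    ∫ x, v x * φ x = ∫ x, u x * leftFracDeriv α φ x

/-- `u(x) → 0` almost everywhere as `|x| → ∞`. -/
def TendsToZeroAEAtInfinity (u : ℝ → ℝ) : Prop :=
  ∀ ε : ℝ, 0 < ε → ∃ R : ℝ, ∀ᵐ x ∂(MeasureTheory.volume : MeasureTheory.Measure ℝ),
    R ≤ |x| → |u x| < ε

open MeasureTheory Set Filter Topology

/-! Write $k_\sigma(t)=t_+^{\sigma-1}/\Gamma(\sigma)$. Both directions rest on the semigroup law
$k_\alpha*k_{1-\alpha}=1_{(0,\infty)}$ (`fracKernel_mul_fracKernel`) and Fubini.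

For part 1, ${}^+D^\alpha\varphi=-{}^+I^{1-\alpha}\varphi'$, so $\int{}^-I^\alpha
v\;{}^+D^\alpha\varphi=-\int v(y)\int_y^\infty\varphi'\,dy=\int v\varphi$.

For the converse, test with $\varphi_n(x)=-\int_x^{x+n}\eta$ and let $n\to\infty$. Since $u\in L^1$
and ${}^+I^{1-\alpha}\eta$ is bounded and vanishes near $+\infty$, no constant of integration
survives: ${}^-I^{1-\alpha}u(x)=V(x):=\int_{-\infty}^x v$ a.e.
(`IsLeftWeakFracDeriv.leftFracInt_ae_eq`). Integrating against $k_\alpha(b-x)-k_\alpha(a-x)$ gives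
$\int_a^b u$ on one side, by the semigroup law, and $\int_a^b{}^-I^\alpha v$ on the other, by Fubini
and adjointness. Lebesgue differentiation concludes. The right-sided statements follow by
$x\mapsto-x$. -/

/-- The convolution kernel `t₊ ^ (σ - 1) / Γ(σ)` of the Liouville fractional integrals. -/
noncomputable def fracKernel (σ t : ℝ) : ℝ :=
  if 0 < t then t ^ (σ - 1) / Real.Gamma σ else 0

theorem measurable_fracKernel (σ : ℝ) : Measurable (fracKernel σ) := by
  unfold fracKernel
  exact Measurable.ite measurableSet_Ioi (by fun_prop) measurable_const

theorem fracKernel_of_nonpos (σ : ℝ) {t : ℝ} (ht : t ≤ 0) : fracKernel σ t = 0 :=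
  if_neg ht.not_gt

theorem fracKernel_of_pos (σ : ℝ) {t : ℝ} (ht : 0 < t) :
    fracKernel σ t = t ^ (σ - 1) / Real.Gamma σ :=
  if_pos ht

theorem fracKernel_nonneg {σ : ℝ} (hσ : 0 < σ) (t : ℝ) : 0 ≤ fracKernel σ t := by
  have := Real.Gamma_pos_of_pos hσ
  unfold fracKernel
  split_ifs <;> positivity

theorem fracKernel_mul_eq_indicator_Iio (σ : ℝ) (f : ℝ → ℝ) (x : ℝ) :
    (fun y => fracKernel σ (x - y) * f y) =
      (Iio x).indicator (fun y => 1 / Real.Gamma σ * (f y / (x - y) ^ (1 - σ))) := by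
  ext y
  by_cases h : y < x
  · rw [indicator_of_mem (show y ∈ Iio x from h), fracKernel_of_pos σ (sub_pos.2 h),
      show σ - 1 = -(1 - σ) by ring, Real.rpow_neg (sub_pos.2 h).le]
    ring
  · rw [indicator_of_notMem (show y ∉ Iio x from h),
      fracKernel_of_nonpos σ (by linarith [not_lt.1 h]), zero_mul]

theorem leftFracInt_eq (σ : ℝ) (f : ℝ → ℝ) (x : ℝ) :
    leftFracInt σ f x = ∫ y, fracKernel σ (x - y) * f y := by
  rw [fracKernel_mul_eq_indicator_Iio, integral_indicator measurableSet_Iio, leftFracInt,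
    integral_const_mul]

theorem rightFracInt_eq_leftFracInt_comp_neg (σ : ℝ) (f : ℝ → ℝ) (x : ℝ) :
    rightFracInt σ f x = leftFracInt σ (fun y => f (-y)) (-x) := by
  unfold rightFracInt leftFracInt
  congr 1
  rw [← integral_Iic_eq_integral_Iio]
  have h := integral_comp_neg_Iic (-x) fun y => f y / (y - x) ^ (1 - σ)
  rw [neg_neg] at h
  rw [← h]
  simp [sub_eq_add_neg, add_comm]

theorem rightFracInt_eq (σ : ℝ) (f : ℝ → ℝ) (x : ℝ) :
    rightFracInt σ f x = ∫ y, fracKernel σ (y - x) * f y := by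
  rw [rightFracInt_eq_leftFracInt_comp_neg, leftFracInt_eq,
    ← integral_neg_eq_self (fun y => fracKernel σ (y - x) * f y)]
  simp [sub_eq_add_neg, add_comm]

/-! ### Integrability of the kernel -/

theorem integrableOn_fracKernel_Ioc {σ : ℝ} (hσ : 0 < σ) (T : ℝ) :
    IntegrableOn (fracKernel σ) (Ioc 0 T) := by
  rcases le_or_gt T 0 with hT | hT
  · simp [Ioc_eq_empty_of_le hT]
  have h : IntervalIntegrable (fun t : ℝ => t ^ (σ - 1) / Real.Gamma σ) volume 0 T :=
    (intervalIntegral.intervalIntegrable_rpow' (by linarith)).div_const _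
  rw [intervalIntegrable_iff_integrableOn_Ioc_of_le hT.le] at h
  exact h.congr_fun (fun t ht => (fracKernel_of_pos σ ht.1).symm) measurableSet_Ioc

/-- An $L^1+L^\infty$ splitting: the singularity at $0$ is integrable, and for $\sigma\le1$ the tail
is bounded by its value at $1$. -/
theorem fracKernel_le {σ : ℝ} (hσ : 0 < σ) (hσ1 : σ ≤ 1) (t : ℝ) :
    fracKernel σ t ≤ (Ioc 0 1).indicator (fracKernel σ) t + 1 / Real.Gamma σ := by
  have hΓ := Real.Gamma_pos_of_pos hσ
  by_cases h : t ∈ Ioc (0 : ℝ) 1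
  · rw [indicator_of_mem h]
    have : 0 < 1 / Real.Gamma σ := by positivity
    linarith
  · rw [indicator_of_notMem h, zero_add]
    rcases le_or_gt t 0 with h0 | h0
    · rw [fracKernel_of_nonpos σ h0]; positivity
    · have h1 : 1 < t := by
        by_contra h1
        exact h ⟨h0, not_lt.1 h1⟩
      rw [fracKernel_of_pos σ h0]
      gcongr
      exact Real.rpow_le_one_of_one_le_of_nonpos h1.le (by linarith)

theorem integrable_indicator_fracKernel {σ : ℝ} (hσ : 0 < σ) :
    Integrable ((Ioc 0 1).indicator (fracKernel σ)) :=
  (integrableOn_fracKernel_Ioc hσ 1).integrable_indicator measurableSet_Ioc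

theorem locallyIntegrable_fracKernel {σ : ℝ} (hσ : 0 < σ) (hσ1 : σ ≤ 1) :
    LocallyIntegrable (fracKernel σ) := by
  refine ((integrable_indicator_fracKernel hσ).locallyIntegrable.add
    (locallyIntegrable_const (1 / Real.Gamma σ))).mono
    (measurable_fracKernel σ).aestronglyMeasurable (Eventually.of_forall fun t => ?_)
  rw [Real.norm_of_nonneg (fracKernel_nonneg hσ t)]
  exact (fracKernel_le hσ hσ1 t).trans (Real.le_norm_self _)

/-- The right fractional integral of a bounded integrable function is absolutely convergent, with
a uniform bound. -/
theorem exists_bound_integral_fracKernel_mul {σ : ℝ} (hσ : 0 < σ) (hσ1 : σ ≤ 1) {η : ℝ → ℝ}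
    (hη : Integrable η) {M : ℝ} (hM : ∀ x, |η x| ≤ M) :
    (∀ y, Integrable (fun x => fracKernel σ (x - y) * η x)) ∧
      ∃ B, ∀ y, ∫ x, |fracKernel σ (x - y) * η x| ≤ B := by
  set N := (Ioc 0 1).indicator (fracKernel σ) with hN
  have hNn : ∀ t, 0 ≤ N t := fun t => indicator_nonneg (fun s _ => fracKernel_nonneg hσ s) t
  have hle : ∀ y x, |fracKernel σ (x - y) * η x| ≤
      N (x - y) * M + 1 / Real.Gamma σ * |η x| := by
    intro y x
    rw [abs_mul, abs_of_nonneg (fracKernel_nonneg hσ _)]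
    have h1 := mul_le_mul_of_nonneg_right (fracKernel_le hσ hσ1 (x - y)) (abs_nonneg (η x))
    have h2 := mul_le_mul_of_nonneg_left (hM x) (hNn (x - y))
    rw [add_mul] at h1
    linarith
  have hint : ∀ y, Integrable (fun x => N (x - y) * M + 1 / Real.Gamma σ * |η x|) := fun y =>
    (((integrable_indicator_fracKernel hσ).comp_sub_right y).mul_const M).add
      (hη.abs.const_mul _)
  have hk : ∀ y, Integrable (fun x => fracKernel σ (x - y) * η x) := fun y =>
    (hint y).mono' ((((measurable_fracKernel σ).comp
      (measurable_id.sub_const y)).aestronglyMeasurable).mul hη.1)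
      (Eventually.of_forall (hle y))
  refine ⟨hk, (∫ x, N x) * M + 1 / Real.Gamma σ * ∫ x, |η x|, fun y => ?_⟩
  refine (integral_mono (hk y).abs (hint y) (hle y)).trans_eq ?_
  rw [integral_add (((integrable_indicator_fracKernel hσ).comp_sub_right y).mul_const M)
      (hη.abs.const_mul _), integral_mul_const, integral_const_mul,
    integral_sub_right_eq_self N y]

/-! ### The semigroup law, via the Beta distribution -/

theorem integrable_betaPDFReal {a b : ℝ} (ha : 0 < a) (hb : 0 < b) :
    Integrable (ProbabilityTheory.betaPDFReal a b) ∧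
      ∫ x, ProbabilityTheory.betaPDFReal a b x = 1 := by
  have hnn : ∀ x, 0 ≤ ProbabilityTheory.betaPDFReal a b x := by
    intro x
    by_cases h : 0 < x ∧ x < 1
    · exact (ProbabilityTheory.betaPDFReal_pos h.1 h.2 ha hb).le
    · simp [ProbabilityTheory.betaPDFReal, h]
  have h1 := ProbabilityTheory.lintegral_betaPDF_eq_one ha hb
  have hm := (ProbabilityTheory.measurable_betaPDFReal a b).aestronglyMeasurable (μ := volume)
  unfold ProbabilityTheory.betaPDF at h1
  constructor
  · refine ⟨hm, ?_⟩
    rw [hasFiniteIntegral_iff_ofReal (Eventually.of_forall hnn), h1]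
    exact ENNReal.one_lt_top
  · rw [integral_eq_lintegral_of_nonneg_ae (Eventually.of_forall hnn) hm, h1]
    simp

/-- The semigroup law `k_α * k_{1-α} = k_1` of the fractional kernels. -/
theorem fracKernel_mul_fracKernel {α : ℝ} (hα0 : 0 < α) (hα1 : α < 1) (y z : ℝ) :
    Integrable (fun x => fracKernel α (x - y) * fracKernel (1 - α) (z - x)) ∧
      ∫ x, fracKernel α (x - y) * fracKernel (1 - α) (z - x) = if y < z then 1 else 0 := by
  have hα : 0 < 1 - α := by linarith
  by_cases h : y < z
  · have hc : 0 < z - y := sub_pos.2 h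
    -- Rescaled from $(y,z)$ to $(0,1)$, the product is the Beta$(\alpha,1-\alpha)$ density, whose
    -- constant is $\Gamma(\alpha)\Gamma(1-\alpha)$ because $\Gamma(1)=1$.
    have key : (fun x => fracKernel α (x - y) * fracKernel (1 - α) (z - x)) =
        fun x => (z - y)⁻¹ * ProbabilityTheory.betaPDFReal α (1 - α) ((x - y) / (z - y)) := by
      ext x
      unfold ProbabilityTheory.betaPDFReal ProbabilityTheory.beta
      have h01 : (0 < (x - y) / (z - y) ∧ (x - y) / (z - y) < 1) ↔ 0 < x - y ∧ 0 < z - x := by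
        rw [div_lt_one hc, div_pos_iff_of_pos_right hc]
        constructor <;> rintro ⟨h1, h2⟩ <;> constructor <;> linarith
      by_cases hx : 0 < x - y ∧ 0 < z - x
      · rw [if_pos (h01.2 hx), fracKernel_of_pos _ hx.1, fracKernel_of_pos _ hx.2,
          show 1 - (x - y) / (z - y) = (z - x) / (z - y) by field_simp; ring,
          Real.div_rpow hx.1.le hc.le, Real.div_rpow hx.2.le hc.le]
        have e : (z - y) ^ (α - 1) * (z - y) ^ (1 - α - 1) = (z - y)⁻¹ := by
          rw [← Real.rpow_add hc, ← Real.rpow_neg_one]; ring_nf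
        have hg1 := Real.Gamma_pos_of_pos hα0
        have hg2 := Real.Gamma_pos_of_pos hα
        have p1 := Real.rpow_pos_of_pos hc (α - 1)
        have p2 := Real.rpow_pos_of_pos hc (1 - α - 1)
        rw [← e, show α + (1 - α) = 1 by ring, Real.Gamma_one]
        field_simp
      · rw [if_neg (fun hh => hx (h01.1 hh)), mul_zero]
        rcases not_and_or.1 hx with hx | hx
        · rw [fracKernel_of_nonpos _ (not_lt.1 hx), zero_mul]
        · rw [fracKernel_of_nonpos (1 - α) (not_lt.1 hx), mul_zero]
    obtain ⟨hi, h1⟩ := integrable_betaPDFReal hα0 hα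
    rw [key, if_pos h]
    constructor
    · exact (((hi.comp_div hc.ne').comp_sub_right y)).const_mul _
    · rw [integral_const_mul, integral_sub_right_eq_self
        (fun x => ProbabilityTheory.betaPDFReal α (1 - α) (x / (z - y))) y,
        Measure.integral_comp_div, h1, abs_of_pos hc]
      simp [hc.ne']
  · have key : (fun x => fracKernel α (x - y) * fracKernel (1 - α) (z - x)) = fun _ => 0 := by
      ext x
      rcases le_or_gt x y with hx | hx
      · rw [fracKernel_of_nonpos _ (by linarith), zero_mul]
      · rw [fracKernel_of_nonpos (1 - α) (by linarith), mul_zero]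
    rw [key, if_neg h]
    simp

/-- The fractional integral is a convolution with the reflected, locally integrable kernel, so the
derivative may fall on the test function. -/
theorem rightFracDeriv_eq {α : ℝ} (hα0 : 0 < α) (hα1 : α < 1) {φ : ℝ → ℝ} (hφ : ContDiff ℝ ∞ φ)
    (hc : HasCompactSupport φ) (x : ℝ) :
    rightFracDeriv α φ x = -∫ y, fracKernel (1 - α) (y - x) * deriv φ y := by
  have hli : LocallyIntegrable (fun t => fracKernel (1 - α) (-t)) := by
    have h := locallyIntegrable_fracKernel (show 0 < 1 - α by linarith) (by linarith)
    have h2 := (Measure.measurePreserving_neg (volume : Measure ℝ))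
    rw [← h2.map_eq] at h
    exact (locallyIntegrable_map_homeomorph (Homeomorph.neg ℝ)).1 h
  have conv : ∀ ψ : ℝ → ℝ, (convolution ψ (fun t => fracKernel (1 - α) (-t))
      (ContinuousLinearMap.mul ℝ ℝ) volume) =
      fun x => ∫ y, fracKernel (1 - α) (y - x) * ψ y := by
    intro ψ
    ext x
    simp only [convolution, ContinuousLinearMap.mul_apply', neg_sub]
    simp_rw [mul_comm]
  have h := hc.hasDerivAt_convolution_left (ContinuousLinearMap.mul ℝ ℝ)
    (hφ.of_le (by simp)) hli x
  rw [conv, conv] at h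
  rw [rightFracDeriv, show rightFracInt (1 - α) φ = _ from funext (rightFracInt_eq (1 - α) φ),
    h.deriv]

/-- Translation differences of the kernel are integrable on the line. -/
theorem integrable_fracKernel_sub {σ : ℝ} (hσ : 0 < σ) (hσ1 : σ ≤ 1) {a b : ℝ} (hab : a ≤ b) :
    Integrable (fun x => fracKernel σ (b - x) - fracKernel σ (a - x)) := by
  set h := b - a with hh
  have h0 : 0 ≤ h := sub_nonneg.2 hab
  have hk : ∀ c T : ℝ, IntegrableOn (fun t => fracKernel σ (t + c)) (Ioc 0 T) := by
    intro c T
    have h1 := ((locallyIntegrable_fracKernel hσ hσ1).integrableOn_isCompact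
      (isCompact_Icc (a := c) (b := T + c)))
    have h2 := (measurePreserving_add_right (volume : Measure ℝ) c).integrableOn_comp_preimage
      (measurableEmbedding_addRight c) (f := fracKernel σ) (s := Icc c (T + c))
    refine (h2.2 h1).mono_set fun t ht => ?_
    simp only [mem_preimage, mem_Icc]
    constructor <;> linarith [ht.1, ht.2]
  suffices H : Integrable (fun t => fracKernel σ (t + h) - fracKernel σ t) by
    refine (H.comp_sub_left a).congr (Eventually.of_forall fun x => ?_)
    simp [hh]
  have hd : ∀ T : ℝ, IntegrableOn (fun t => fracKernel σ (t + h) - fracKernel σ t) (Ioc 0 T) :=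
    fun T => (hk h T).sub (integrableOn_fracKernel_Ioc hσ T)
  -- On $t>0$ the kernel is nonincreasing, so the norm is $k(t)-k(t+h)$ and its integral telescopes
  -- to $\int_0^h k-\int_T^{T+h}k\le\int_0^h k$, uniformly in $T$.
  have hpos : IntegrableOn (fun t => fracKernel σ (t + h) - fracKernel σ t) (Ioi 0) := by
    refine integrableOn_Ioi_of_intervalIntegral_norm_bounded (∫ t in (0 : ℝ)..h, fracKernel σ t) 0
      hd tendsto_id ?_
    filter_upwards [eventually_ge_atTop 0] with T hT
    have hii : ∀ s t : ℝ, IntervalIntegrable (fracKernel σ) volume s t := fun s t =>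
      ((locallyIntegrable_fracKernel hσ hσ1).integrableOn_isCompact isCompact_uIcc).intervalIntegrable
    have e : ∫ t in (0 : ℝ)..T, ‖fracKernel σ (t + h) - fracKernel σ t‖ =
        ∫ t in (0 : ℝ)..T, (fracKernel σ t - fracKernel σ (t + h)) := by
      refine intervalIntegral.integral_congr_ae (Eventually.of_forall fun t ht => ?_)
      rw [uIoc_of_le hT] at ht
      rw [Real.norm_of_nonpos, neg_sub]
      rw [fracKernel_of_pos σ ht.1, fracKernel_of_pos σ (by linarith [ht.1]), sub_nonpos]
      have := Real.Gamma_pos_of_pos hσ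
      gcongr ?_ / _
      exact Real.rpow_le_rpow_of_nonpos ht.1 (by linarith) (by linarith)
    rw [e, intervalIntegral.integral_sub (hii _ _)
      ((intervalIntegrable_iff_integrableOn_Ioc_of_le hT).2 (hk h T)),
      intervalIntegral.integral_comp_add_right, zero_add,
      intervalIntegral.integral_interval_sub_interval_comm (hii _ _) (hii _ _) (hii _ _)]
    have := intervalIntegral.integral_nonneg (μ := volume) (f := fracKernel σ)
      (show T ≤ T + h by linarith) (fun t _ => fracKernel_nonneg hσ t)
    linarith
  have hneg : IntegrableOn (fun t => fracKernel σ (t + h) - fracKernel σ t) (Iic 0) := by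
    have h1 : IntegrableOn (fun t => fracKernel σ (t + h)) (Iic 0) := by
      have h2 := (((integrableOn_fracKernel_Ioc hσ h).integrable_indicator
        measurableSet_Ioc).comp_add_right h).integrableOn (s := Iic 0)
      refine h2.congr_fun (fun t ht => ?_) measurableSet_Iic
      have ht : t ≤ 0 := ht
      beta_reduce
      by_cases h3 : 0 < t + h
      · rw [indicator_of_mem (show t + h ∈ Ioc 0 h from ⟨h3, by linarith⟩)]
      · rw [indicator_of_notMem (show t + h ∉ Ioc 0 h from fun h4 => h3 h4.1), fracKernel_of_nonpos σ (not_lt.1 h3)]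
    refine h1.congr_fun (fun t ht => ?_) measurableSet_Iic
    rw [fracKernel_of_nonpos σ ht, sub_zero]
  rw [← integrableOn_univ, ← Iic_union_Ioi (a := (0 : ℝ))]
  exact hneg.union hpos

/-! ### Fubini identities and adjointness -/

theorem integral_mul_integral_Ioi {f g : ℝ → ℝ} (hf : Integrable f) (hg : Integrable g) :
    ∫ x, f x * ∫ y in Ioi x, g y = ∫ y, (∫ x in Iio y, f x) * g y := by
  have hS : MeasurableSet {p : ℝ × ℝ | p.1 < p.2} := measurableSet_lt measurable_fst measurable_snd
  have h := integral_integral_swap (f := fun x y => {p : ℝ × ℝ | p.1 < p.2}.indicator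
    (fun p => f p.1 * g p.2) (x, y)) ((hf.mul_prod hg).indicator hS)
  have h1 : ∀ x, ∫ y, {p : ℝ × ℝ | p.1 < p.2}.indicator (fun p => f p.1 * g p.2) (x, y) =
      f x * ∫ y in Ioi x, g y := fun x => by
    rw [← integral_const_mul, ← integral_indicator measurableSet_Ioi]
    rfl
  have h2 : ∀ y, ∫ x, {p : ℝ × ℝ | p.1 < p.2}.indicator (fun p => f p.1 * g p.2) (x, y) =
      (∫ x in Iio y, f x) * g y := fun y => by
    rw [← integral_mul_const, ← integral_indicator measurableSet_Iio]
    rfl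
  simpa only [h1, h2] using h

/-- Integrating first in $x$ collapses the two kernels to $1_{y<z}$, so the triple integral is
dominated by $\|f\|_1\|g\|_1$ and no boundedness is needed. -/
theorem integral_leftFracInt_mul_rightFracInt {α : ℝ} (hα0 : 0 < α) (hα1 : α < 1) {f g : ℝ → ℝ}
    (hf : Integrable f) (hg : Integrable g) :
    ∫ x, leftFracInt α f x * rightFracInt (1 - α) g x = ∫ y, f y * ∫ z in Ioi y, g z := by
  have hα : 0 < 1 - α := by linarith
  have hfg := hf.mul_prod hg
  let F : ℝ → ℝ × ℝ → ℝ := fun x p =>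
    (fracKernel α (x - p.1) * fracKernel (1 - α) (p.2 - x)) * (f p.1 * g p.2)
  have hF : AEStronglyMeasurable (Function.uncurry F) (volume.prod (volume.prod volume)) := by
    refine AEStronglyMeasurable.mul ?_ hfg.1.comp_snd
    exact (((measurable_fracKernel α).comp (by fun_prop)).mul
      ((measurable_fracKernel (1 - α)).comp (by fun_prop))).aestronglyMeasurable
  have hS : MeasurableSet {p : ℝ × ℝ | p.1 < p.2} := measurableSet_lt measurable_fst measurable_snd
  have hFi : Integrable (Function.uncurry F) (volume.prod (volume.prod volume)) := by
    rw [integrable_prod_iff' hF]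
    refine ⟨Eventually.of_forall fun p => (fracKernel_mul_fracKernel hα0 hα1 p.1 p.2).1.mul_const
      (f p.1 * g p.2), ?_⟩
    refine (hfg.norm.indicator hS).congr (Eventually.of_forall fun p => ?_)
    have e : ∀ x, ‖Function.uncurry F (x, p)‖ =
        (fracKernel α (x - p.1) * fracKernel (1 - α) (p.2 - x)) * ‖f p.1 * g p.2‖ := fun x => by
      change ‖(fracKernel α (x - p.1) * fracKernel (1 - α) (p.2 - x)) * (f p.1 * g p.2)‖ = _
      rw [norm_mul, Real.norm_of_nonneg
        (mul_nonneg (fracKernel_nonneg hα0 _) (fracKernel_nonneg hα _))]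
    simp_rw [e]
    rw [integral_mul_const, (fracKernel_mul_fracKernel hα0 hα1 _ _).2]
    by_cases h : p.1 < p.2 <;> simp [indicator, h]
  have h : ∫ x, ∫ p, F x p = ∫ p, ∫ x, F x p := integral_integral_swap hFi
  have h1 : ∀ x, ∫ p, F x p = leftFracInt α f x * rightFracInt (1 - α) g x := fun x => by
    rw [leftFracInt_eq, rightFracInt_eq, ← integral_prod_mul]
    refine integral_congr_ae (Eventually.of_forall fun p => ?_)
    change _ * _ * (_ * _) = _
    ring
  have h2 : ∀ p : ℝ × ℝ, ∫ x, F x p =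
      {p : ℝ × ℝ | p.1 < p.2}.indicator (fun p => f p.1 * g p.2) p := fun p => by
    rw [integral_mul_const, (fracKernel_mul_fracKernel hα0 hα1 _ _).2]
    by_cases h : p.1 < p.2 <;> simp [indicator, h]
  simp_rw [h1, h2] at h
  rw [h]
  refine (integral_prod _ (hfg.indicator hS)).trans (integral_congr_ae
    (Eventually.of_forall fun y => ?_))
  beta_reduce
  rw [← integral_const_mul, ← integral_indicator measurableSet_Ioi]
  rfl

/-- The left fractional integral inverts the adjoint fractional derivative. -/
theorem integral_leftFracInt_mul_rightFracDeriv {α : ℝ} (hα0 : 0 < α) (hα1 : α < 1) {v φ : ℝ → ℝ}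
    (hv : Integrable v) (hφ : ContDiff ℝ ∞ φ) (hc : HasCompactSupport φ) :
    ∫ x, leftFracInt α v x * rightFracDeriv α φ x = ∫ x, v x * φ x := by
  have h1 : ContDiff ℝ 1 φ := hφ.of_le (by simp)
  have hd : Integrable (deriv φ) := (h1.continuous_deriv le_rfl).integrable_of_hasCompactSupport
    hc.deriv
  have h := integral_leftFracInt_mul_rightFracInt hα0 hα1 hv hd
  simp_rw [hc.integral_Ioi_deriv_eq h1, mul_neg] at h
  rw [integral_neg] at h
  simp_rw [rightFracDeriv_eq hα0 hα1 hφ hc, ← rightFracInt_eq, mul_neg]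
  rw [integral_neg, h, neg_neg]

theorem integral_fracKernel_mul_leftFracInt {α : ℝ} (hα0 : 0 < α) (hα1 : α < 1) {u : ℝ → ℝ}
    (hu : Integrable u) (b : ℝ) :
    Integrable (fun x => fracKernel α (b - x) * leftFracInt (1 - α) u x) ∧
      ∫ x, fracKernel α (b - x) * leftFracInt (1 - α) u x = ∫ y in Iio b, u y := by
  have hα : 0 < 1 - α := by linarith
  let F : ℝ → ℝ → ℝ := fun x y =>
    (fracKernel (1 - α) (x - y) * fracKernel α (b - x)) * u y
  have key : ∀ y, Integrable (fun x => fracKernel (1 - α) (x - y) * fracKernel α (b - x)) ∧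
      ∫ x, fracKernel (1 - α) (x - y) * fracKernel α (b - x) = if y < b then 1 else 0 := fun y => by
    simpa using fracKernel_mul_fracKernel hα (by linarith) y b
  have hF : AEStronglyMeasurable (Function.uncurry F) (volume.prod volume) := by
    refine AEStronglyMeasurable.mul ?_ hu.1.comp_snd
    exact (((measurable_fracKernel (1 - α)).comp (by fun_prop)).mul
      ((measurable_fracKernel α).comp (by fun_prop))).aestronglyMeasurable
  have hFi : Integrable (Function.uncurry F) (volume.prod volume) := by
    rw [integrable_prod_iff' hF]
    refine ⟨Eventually.of_forall fun y => (key y).1.mul_const (u y), ?_⟩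
    refine (hu.norm.indicator (measurableSet_Iio (a := b))).congr (Eventually.of_forall fun y => ?_)
    have e : ∀ x, ‖Function.uncurry F (x, y)‖ =
        (fracKernel (1 - α) (x - y) * fracKernel α (b - x)) * ‖u y‖ := fun x => by
      change ‖(fracKernel (1 - α) (x - y) * fracKernel α (b - x)) * u y‖ = _
      rw [norm_mul, Real.norm_of_nonneg
        (mul_nonneg (fracKernel_nonneg hα _) (fracKernel_nonneg hα0 _))]
    simp_rw [e]
    rw [integral_mul_const, (key y).2]
    by_cases h : y < b <;> simp [indicator, h]
  have h1 : ∀ x, ∫ y, F x y = fracKernel α (b - x) * leftFracInt (1 - α) u x := fun x => by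
    rw [leftFracInt_eq, ← integral_const_mul]
    refine integral_congr_ae (Eventually.of_forall fun p => ?_)
    change _ * _ * _ = _
    ring
  have h2 : ∀ y, ∫ x, F x y = (Iio b).indicator u y := fun y => by
    rw [integral_mul_const, (key y).2]
    by_cases h : y < b <;> simp [indicator, h]
  constructor
  · exact hFi.integral_prod_left.congr (Eventually.of_forall h1)
  · have h := integral_integral_swap hFi
    simp_rw [h1, h2] at h
    rw [h, integral_indicator measurableSet_Iio]

theorem integrable_fracKernel_mul_mul {σ : ℝ} (hσ : 0 < σ) (hσ1 : σ ≤ 1) {u η : ℝ → ℝ}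
    (hu : Integrable u) (hη : Integrable η) {M : ℝ} (hM : ∀ x, |η x| ≤ M) :
    Integrable (Function.uncurry fun x y => fracKernel σ (x - y) * u y * η x)
      (volume.prod volume) := by
  have hm : AEStronglyMeasurable (Function.uncurry fun x y => fracKernel σ (x - y) * u y * η x)
      (volume.prod volume) := by
    refine AEStronglyMeasurable.mul (AEStronglyMeasurable.mul ?_ hu.1.comp_snd) hη.1.comp_fst
    exact ((measurable_fracKernel σ).comp (by fun_prop)).aestronglyMeasurable
  obtain ⟨hi, B, hB⟩ := exists_bound_integral_fracKernel_mul hσ hσ1 hη hM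
  rw [integrable_prod_iff' hm]
  refine ⟨Eventually.of_forall fun y => ((hi y).mul_const (u y)).congr
    (Eventually.of_forall fun x => ?_), ?_⟩
  · change _ * _ * _ = _ * _ * _
    ring
  refine (hu.norm.mul_const B).mono' hm.norm.prod_swap.integral_prod_right'
    (Eventually.of_forall fun y => ?_)
  have e : ∀ x, ‖Function.uncurry (fun x y => fracKernel σ (x - y) * u y * η x) (x, y)‖ =
      ‖u y‖ * |fracKernel σ (x - y) * η x| := fun x => by
    change ‖_ * _ * _‖ = _
    rw [← Real.norm_eq_abs, ← norm_mul]
    congr 1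
    ring
  simp_rw [e]
  rw [integral_const_mul, norm_mul, norm_norm]
  gcongr
  rw [Real.norm_of_nonneg (integral_nonneg fun x => abs_nonneg _)]
  exact hB y

/-- Fractional integration by parts; boundedness of $\eta$ tames the singularity of the kernel and
its integrability the tail. -/
theorem integral_leftFracInt_mul {σ : ℝ} (hσ : 0 < σ) (hσ1 : σ ≤ 1) {u η : ℝ → ℝ}
    (hu : Integrable u) (hη : Integrable η) {M : ℝ} (hM : ∀ x, |η x| ≤ M) :
    Integrable (fun x => leftFracInt σ u x * η x) ∧
      ∫ x, leftFracInt σ u x * η x = ∫ y, u y * rightFracInt σ η y := by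
  have hi := integrable_fracKernel_mul_mul hσ hσ1 hu hη hM
  have h1 : ∀ x, ∫ y, fracKernel σ (x - y) * u y * η x = leftFracInt σ u x * η x := fun x => by
    rw [integral_mul_const, leftFracInt_eq]
  have h2 : ∀ y, ∫ x, fracKernel σ (x - y) * u y * η x = u y * rightFracInt σ η y := fun y => by
    rw [rightFracInt_eq, ← integral_const_mul]
    refine integral_congr_ae (Eventually.of_forall fun p => ?_)
    ring
  refine ⟨hi.integral_prod_left.congr (Eventually.of_forall h1), ?_⟩
  have h := integral_integral_swap hi
  simpa only [h1, h2] using h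

theorem abs_indicator_one_le (s : Set ℝ) (x : ℝ) : |s.indicator (1 : ℝ → ℝ) x| ≤ 1 := by
  by_cases h : x ∈ s <;> simp [h]

theorem integrableOn_leftFracInt {σ : ℝ} (hσ : 0 < σ) (hσ1 : σ ≤ 1) {u : ℝ → ℝ}
    (hu : Integrable u) {s : Set ℝ} (hs : MeasurableSet s) (hs' : volume s ≠ ⊤) :
    IntegrableOn (leftFracInt σ u) s := by
  have h1 : Integrable (s.indicator (1 : ℝ → ℝ)) :=
    (integrable_indicator_iff hs).2 (integrableOn_const hs')
  have h := (integral_leftFracInt_mul hσ hσ1 hu h1 (abs_indicator_one_le s)).1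
  rw [← integrable_indicator_iff hs]
  refine h.congr (Eventually.of_forall fun x => ?_)
  by_cases h : x ∈ s <;> simp [h]

theorem locallyIntegrable_leftFracInt {σ : ℝ} (hσ : 0 < σ) (hσ1 : σ ≤ 1) {u : ℝ → ℝ}
    (hu : Integrable u) : LocallyIntegrable (leftFracInt σ u) :=
  locallyIntegrable_iff.2 fun _ hk =>
    integrableOn_leftFracInt hσ hσ1 hu hk.measurableSet hk.measure_lt_top.ne

theorem ae_integrable_fracKernel_mul {σ : ℝ} (hσ : 0 < σ) (hσ1 : σ ≤ 1) {u : ℝ → ℝ}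
    (hu : Integrable u) : ∀ᵐ x, Integrable (fun y => fracKernel σ (x - y) * u y) := by
  -- Fubini needs an integrable cutoff in $x$; countably many intervals exhaust the line.
  have h : ∀ n : ℕ, ∀ᵐ x, Integrable (fun y => fracKernel σ (x - y) * u y *
      (Icc (-n : ℝ) n).indicator (1 : ℝ → ℝ) x) := fun n =>
    (integrable_fracKernel_mul_mul hσ hσ1 hu ((integrable_indicator_iff measurableSet_Icc).2
      (integrableOn_const (by simp))) (abs_indicator_one_le (Icc (-n : ℝ) n))).prod_right_ae
  filter_upwards [ae_all_iff.2 h] with x hx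
  obtain ⟨n, hn⟩ := exists_nat_ge |x|
  simpa [abs_le.1 hn] using hx n

/-- Each term is $\int_{-\infty}^{c-y}k_\sigma$, so the difference is
$\int_{a-y}^{b-y}k_\sigma=\int_a^b k_\sigma(x-y)\,dx$. -/
theorem integral_Ioi_fracKernel_sub {σ : ℝ} (hσ : 0 < σ) {a b : ℝ} (hab : a ≤ b)
    (y : ℝ) : ∫ x in Ioi y, (fracKernel σ (b - x) - fracKernel σ (a - x)) =
      rightFracInt σ ((Ioc a b).indicator 1) y := by
  have hI : ∀ s, IntegrableOn (fracKernel σ) (Iic s) := fun s => by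
    have h := ((integrableOn_fracKernel_Ioc hσ s).integrable_indicator
      measurableSet_Ioc).integrableOn (s := Iic s)
    refine h.congr_fun (fun t ht => ?_) measurableSet_Iic
    by_cases h3 : 0 < t
    · rw [indicator_of_mem (show t ∈ Ioc 0 s from ⟨h3, ht⟩)]
    · rw [indicator_of_notMem (show t ∉ Ioc 0 s from fun h4 => h3 h4.1),
        fracKernel_of_nonpos σ (not_lt.1 h3)]
  have hmp : ∀ c : ℝ, MeasurePreserving (fun x : ℝ => c - x) volume volume := fun c =>
    Measure.measurePreserving_sub_left volume c
  have hemb : ∀ c : ℝ, MeasurableEmbedding (fun x : ℝ => c - x) := fun c =>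
    (Homeomorph.subLeft c).measurableEmbedding
  have hpre : ∀ c : ℝ, (fun x : ℝ => c - x) ⁻¹' Iio (c - y) = Ioi y := fun c => by
    ext x; simp
  have hc : ∀ c : ℝ, ∫ x in Ioi y, fracKernel σ (c - x) = ∫ t in Iic (c - y), fracKernel σ t :=
    fun c => by
      rw [integral_Iic_eq_integral_Iio, ← hpre c,
        (hmp c).setIntegral_preimage_emb (hemb c) (fracKernel σ)]
  have hci : ∀ c : ℝ, IntegrableOn (fun x => fracKernel σ (c - x)) (Ioi y) := fun c => by
    rw [← hpre c]
    exact ((hmp c).integrableOn_comp_preimage (hemb c)).2 ((hI _).mono_set Iio_subset_Iic_self)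
  rw [integral_sub (hci b) (hci a), hc, hc, intervalIntegral.integral_Iic_sub_Iic (hI _) (hI _),
    ← intervalIntegral.integral_comp_sub_right, intervalIntegral.integral_of_le hab,
    rightFracInt_eq, ← integral_indicator measurableSet_Ioc]
  congr 1
  ext x
  by_cases h : x ∈ Ioc a b <;> simp [h]

/-! ### The converse: inverting the weak derivative -/

/-- A primitive of $\eta$ has compact support only when $\int\eta=0$; subtracting a translate of
$\eta$ restores zero mean and yields an admissible test function. -/
theorem exists_contDiff_hasCompactSupport_deriv_eq {η : ℝ → ℝ} (hη : ContDiff ℝ ∞ η)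
    (hc : HasCompactSupport η) (T : ℝ) :
    ContDiff ℝ ∞ (fun x => -∫ t in x..x + T, η t) ∧
      HasCompactSupport (fun x => -∫ t in x..x + T, η t) ∧
      ∀ x, deriv (fun x => -∫ t in x..x + T, η t) x = η x - η (x + T) := by
  have hcont := hη.continuous
  set H : ℝ → ℝ := fun x => ∫ t in (0 : ℝ)..x, η t with hH
  have hHd : ∀ x, HasDerivAt H (η x) x := fun x =>
    (hcont.integral_hasStrictDerivAt 0 x).hasDerivAt
  have hHs : ContDiff ℝ ∞ H := by
    rw [contDiff_infty_iff_deriv]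
    refine ⟨fun x => (hHd x).differentiableAt, ?_⟩
    rwa [show deriv H = η from funext fun x => (hHd x).deriv]
  have e : (fun x => -∫ t in x..x + T, η t) = fun x => H x - H (x + T) := by
    ext x
    rw [hH]
    beta_reduce
    rw [← intervalIntegral.integral_add_adjacent_intervals
      (hcont.intervalIntegrable 0 x) (hcont.intervalIntegrable x (x + T))]
    ring
  refine ⟨?_, ?_, fun x => ?_⟩
  · rw [e]
    exact hHs.sub (hHs.comp (by fun_prop))
  · obtain ⟨R, hR⟩ := hc.isCompact.isBounded.subset_closedBall 0
    -- A window of length $|T|$ starting at $x$ meets $[-R,R]$ only if $|x|\le R+|T|$.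
    refine HasCompactSupport.intro (isCompact_Icc (a := -R - |T|) (b := R + |T|)) fun x hx => ?_
    rw [neg_eq_zero]
    refine (intervalIntegral.integral_congr (g := fun _ => 0) fun t ht => ?_).trans (by simp)
    by_contra h0
    have := hR (subset_tsupport η h0)
    rw [Metric.mem_closedBall, Real.dist_eq, sub_zero, abs_le] at this
    apply hx
    rw [mem_uIcc] at ht
    have h1 := le_abs_self T
    have h2 := neg_abs_le T
    rcases ht with ht | ht <;> constructor <;> linarith [ht.1, ht.2]
  · rw [e]
    exact ((hHd x).sub ((hHd (x + T)).comp_add_const x T)).deriv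

/-- If `v` is the left weak derivative of order `α` of `u`, then the fractional integral of order
`1 - α` of `u` is the primitive of `v` vanishing at `-∞`. -/
theorem IsLeftWeakFracDeriv.leftFracInt_ae_eq {α : ℝ} (hα0 : 0 < α) (hα1 : α < 1) {u v : ℝ → ℝ}
    (h : IsLeftWeakFracDeriv α u v) (hv : Integrable v) :
    ∀ᵐ x, leftFracInt (1 - α) u x = ∫ y in Iio x, v y := by
  have hα : 0 < 1 - α := by linarith
  have hα' : 1 - α ≤ 1 := by linarith
  have hu := h.integrable
  have hJc : Continuous fun x => ∫ y in Iio x, v y := by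
    have h1 : (fun x => ∫ y in Iio x, v y) = fun x => (∫ y in Iic 0, v y) + ∫ y in (0 : ℝ)..x, v y := by
      ext x
      rw [← integral_Iic_eq_integral_Iio, ← intervalIntegral.integral_Iic_sub_Iic hv.integrableOn
        hv.integrableOn]
      ring
    rw [h1]
    exact continuous_const.add (intervalIntegral.continuous_primitive
      (fun a b => hv.intervalIntegrable) 0)
  refine ae_eq_of_integral_contDiff_smul_eq (locallyIntegrable_leftFracInt hα hα' hu)
    hJc.locallyIntegrable fun η hη hc => ?_
  have hηi : Integrable η := hη.continuous.integrable_of_hasCompactSupport hc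
  obtain ⟨M, hM⟩ := hc.exists_bound_of_continuous hη.continuous
  obtain ⟨hki, B, hB⟩ := exists_bound_integral_fracKernel_mul hα hα' hηi hM
  set θ := rightFracInt (1 - α) η with hθ
  have hθm : Measurable θ := by
    have : θ = fun x => ∫ y, fracKernel (1 - α) (y - x) * η y := funext (rightFracInt_eq _ η)
    rw [this]
    refine (StronglyMeasurable.integral_prod_right (ν := volume)
      (f := fun x y => fracKernel (1 - α) (y - x) * η y) ?_).measurable
    exact (((measurable_fracKernel (1 - α)).comp (by fun_prop)).mul
      (hη.continuous.measurable.comp measurable_snd)).stronglyMeasurable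
  have hθB : ∀ x, ‖θ x‖ ≤ B := fun x => by
    rw [hθ, rightFracInt_eq]
    exact (norm_integral_le_integral_norm _).trans (hB x)
  -- The right integral at $x$ sees only $y>x$, so it vanishes beyond the support of $\eta$.
  have hθ0 : ∀ᶠ x in atTop, θ x = 0 := by
    obtain ⟨R, hR⟩ := hc.isCompact.isBounded.subset_closedBall 0
    filter_upwards [eventually_ge_atTop R] with x hx
    rw [hθ, rightFracInt_eq]
    refine (integral_congr_ae (Eventually.of_forall fun y => ?_)).trans (integral_zero ℝ ℝ)
    by_cases h0 : η y = 0
    · simp [h0]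
    · have := hR (subset_tsupport η h0)
      rw [Metric.mem_closedBall, Real.dist_eq, sub_zero, abs_le] at this
      simp [fracKernel_of_nonpos (1 - α) (show y - x ≤ 0 by linarith)]
  have hint : ∀ T : ℝ, Integrable fun x => u x * θ (x + T) := fun T =>
    hu.mul_bdd (hθm.comp (measurable_add_const T)).aestronglyMeasurable
      (Eventually.of_forall fun x => hθB (x + T))
  have hweak : ∀ n : ℕ, ∫ x, v x * (-∫ t in x..x + n, η t) =
      -(∫ x, u x * θ x) + ∫ x, u x * θ (x + n) := fun n => by
    obtain ⟨h1, h2, h3⟩ := exists_contDiff_hasCompactSupport_deriv_eq hη hc n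
    rw [h.integral_eq _ h1 h2]
    have e : ∀ x, rightFracDeriv α (fun x => -∫ t in x..x + n, η t) x = -θ x + θ (x + n) := by
      intro x
      rw [rightFracDeriv_eq hα0 hα1 h1 h2, hθ, rightFracInt_eq, rightFracInt_eq,
        ← integral_add_right_eq_self (fun y => fracKernel (1 - α) (y - (x + n)) * η y) (n : ℝ)]
      have hs := (hki (x + n)).comp_add_right (n : ℝ)
      simp only [add_sub_add_right_eq_sub] at hs ⊢
      simp_rw [h3, mul_sub]
      rw [integral_sub (hki x) hs]
      ring
    simp_rw [e, mul_add, mul_neg]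
    have h0 := hint 0
    simp only [add_zero] at h0
    rw [integral_add (f := fun x => -(u x * θ x)) h0.neg (hint n), integral_neg]
  have hlim1 : Tendsto (fun n : ℕ => ∫ x, u x * θ (x + n)) atTop (𝓝 0) := by
    have := tendsto_integral_of_dominated_convergence (μ := volume)
      (F := fun (n : ℕ) x => u x * θ (x + n)) (f := fun _ => 0) (fun x => ‖u x‖ * B)
      (fun n => (hint n).1) (hu.norm.mul_const B)
      (fun n => Eventually.of_forall fun x => by
        rw [norm_mul]
        exact mul_le_mul_of_nonneg_left (hθB _) (norm_nonneg _))
      (Eventually.of_forall fun x => by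
        refine tendsto_const_nhds.congr' ?_
        filter_upwards [(tendsto_atTop_add_const_left _ x
          tendsto_natCast_atTop_atTop).eventually hθ0] with n hn
        rw [hn, mul_zero])
    simpa using this
  have hlim2 : Tendsto (fun n : ℕ => ∫ x, v x * (-∫ t in x..x + n, η t)) atTop
      (𝓝 (∫ x, v x * (-∫ t in Ioi x, η t))) := by
    refine tendsto_integral_of_dominated_convergence (fun x => ‖v x‖ * ∫ t, |η t|)
      (fun n => ?_) (hv.norm.mul_const _) (fun n => Eventually.of_forall fun x => ?_)
      (Eventually.of_forall fun x => ?_)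
    · exact hv.1.mul (exists_contDiff_hasCompactSupport_deriv_eq hη hc
        n).1.continuous.aestronglyMeasurable
    · rw [norm_mul, norm_neg]
      refine mul_le_mul_of_nonneg_left ?_ (norm_nonneg _)
      exact intervalIntegral.norm_integral_le_integral_norm_uIoc.trans
        (setIntegral_le_integral hηi.norm (Eventually.of_forall fun x => norm_nonneg _))
    · exact ((intervalIntegral_tendsto_integral_Ioi x hηi.integrableOn
        (tendsto_atTop_add_const_left _ x tendsto_natCast_atTop_atTop)).neg).const_mul _
  simp_rw [hweak] at hlim2
  have hlim := tendsto_nhds_unique hlim2 (hlim1.const_add _)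
  simp_rw [mul_neg] at hlim
  rw [integral_neg, integral_mul_integral_Ioi hv hηi, add_zero, neg_inj,
    ← (integral_leftFracInt_mul hα hα' hu hηi hM).2] at hlim
  simp_rw [smul_eq_mul, mul_comm (η _)]
  exact hlim.symm

theorem ae_eq_of_forall_intervalIntegral_eq {f g : ℝ → ℝ} (hf : LocallyIntegrable f)
    (hg : LocallyIntegrable g)
    (h : ∀ a b, a ≤ b → ∫ x in a..b, f x = ∫ x in a..b, g x) : ∀ᵐ x, f x = g x := by
  filter_upwards [LocallyIntegrable.ae_hasDerivAt_integral hf,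
    LocallyIntegrable.ae_hasDerivAt_integral hg] with x h1 h2
  -- The base point $x-1$ lies to the left of every $y$ near $x$, so the hypothesis on ordered
  -- endpoints applies.
  refine (h1 (x - 1)).unique ((h2 (x - 1)).congr_of_eventuallyEq ?_)
  filter_upwards [eventually_ge_nhds (show x - 1 < x by linarith)] with y hy using h _ _ hy

theorem IsLeftWeakFracDeriv.ae_eq_leftFracInt {α : ℝ} (hα0 : 0 < α) (hα1 : α < 1) {u v : ℝ → ℝ}
    (h : IsLeftWeakFracDeriv α u v) (hv : Integrable v) : ∀ᵐ x, u x = leftFracInt α v x := by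
  have hu := h.integrable
  refine ae_eq_of_forall_intervalIntegral_eq hu.locallyIntegrable
    (locallyIntegrable_leftFracInt hα0 hα1.le hv) fun a b hab => ?_
  obtain ⟨hbi, hb⟩ := integral_fracKernel_mul_leftFracInt hα0 hα1 hu b
  obtain ⟨hai, ha⟩ := integral_fracKernel_mul_leftFracInt hα0 hα1 hu a
  have h1 : Integrable ((Ioc a b).indicator (1 : ℝ → ℝ)) :=
    (integrable_indicator_iff measurableSet_Ioc).2 (integrableOn_const (by simp))
  calc ∫ x in a..b, u x = (∫ y in Iio b, u y) - ∫ y in Iio a, u y := by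
        rw [← intervalIntegral.integral_Iic_sub_Iic hu.integrableOn hu.integrableOn,
          integral_Iic_eq_integral_Iio, integral_Iic_eq_integral_Iio]
    -- The next Fubini step needs an integrable partner for `v`: the difference of kernels is one,
    -- while a single kernel decays too slowly.
    _ = ∫ x, (∫ y in Iio x, v y) * (fracKernel α (b - x) - fracKernel α (a - x)) := by
        rw [← ha, ← hb, ← integral_sub hbi hai]
        refine integral_congr_ae ?_
        filter_upwards [h.leftFracInt_ae_eq hα0 hα1 hv] with x hx
        rw [hx]
        ring
    _ = ∫ y, v y * rightFracInt α ((Ioc a b).indicator 1) y := by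
        rw [← integral_mul_integral_Ioi hv (integrable_fracKernel_sub hα0 hα1.le hab)]
        simp_rw [integral_Ioi_fracKernel_sub hα0 hab]
    _ = ∫ x in a..b, leftFracInt α v x := by
        rw [← (integral_leftFracInt_mul hα0 hα1.le hv h1 (abs_indicator_one_le _)).2,
          intervalIntegral.integral_of_le hab, ← integral_indicator measurableSet_Ioc]
        congr 1
        ext x
        by_cases hx : x ∈ Ioc a b <;> simp [hx]

/-! ### Assembly, and reflection to the right-sided case -/

theorem isLeftWeakFracDeriv_of_ae_eq {α : ℝ} (hα0 : 0 < α) (hα1 : α < 1) {u v : ℝ → ℝ}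
    (hu : Integrable u) (hv : Integrable v) (h : ∀ᵐ x, u x = leftFracInt α v x) :
    IsLeftWeakFracDeriv α u v where
  integrable := hu
  locallyIntegrable := hv.locallyIntegrable
  integral_eq φ hφ hc := by
    rw [← integral_leftFracInt_mul_rightFracDeriv hα0 hα1 hv hφ hc]
    refine integral_congr_ae ?_
    filter_upwards [h] with x hx
    rw [hx]

theorem ae_integrableOn_div_rpow {α : ℝ} (hα0 : 0 < α) (hα1 : α ≤ 1) {v : ℝ → ℝ}
    (hv : Integrable v) : ∀ᵐ x, IntegrableOn (fun y => v y / (x - y) ^ (1 - α)) (Iio x) := by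
  filter_upwards [ae_integrable_fracKernel_mul hα0 hα1 hv] with x hx
  rw [fracKernel_mul_eq_indicator_Iio, integrable_indicator_iff measurableSet_Iio] at hx
  have hΓ := (Real.Gamma_pos_of_pos hα0).ne'
  refine (Integrable.const_mul hx (Real.Gamma α)).congr (Eventually.of_forall fun y => ?_)
  beta_reduce
  field_simp

theorem leftFracDeriv_eq_rightFracDeriv_comp_neg (α : ℝ) (φ : ℝ → ℝ) (x : ℝ) :
    leftFracDeriv α φ x = rightFracDeriv α (fun y => φ (-y)) (-x) := by
  have h : rightFracInt (1 - α) (fun y => φ (-y)) = fun x => leftFracInt (1 - α) φ (-x) := by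
    ext x
    simp [rightFracInt_eq_leftFracInt_comp_neg]
  rw [rightFracDeriv, h, deriv_comp_neg, leftFracDeriv, neg_neg, neg_neg]

theorem isRightWeakFracDeriv_iff (α : ℝ) {u v : ℝ → ℝ} (hv : Integrable v) :
    IsRightWeakFracDeriv α u v ↔
      IsLeftWeakFracDeriv α (fun x => u (-x)) (fun x => v (-x)) := by
  have key : ∀ φ : ℝ → ℝ, ∫ x, v (-x) * φ (-x) = ∫ x, v x * φ x := fun φ =>
    integral_neg_eq_self (fun x => v x * φ x) volume
  have key2 : ∀ φ : ℝ → ℝ, ∫ x, u (-x) * rightFracDeriv α (fun y => φ (-y)) x =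
      ∫ x, u x * leftFracDeriv α φ x := fun φ => by
    rw [← integral_neg_eq_self (fun x => u x * leftFracDeriv α φ x) volume]
    simp_rw [leftFracDeriv_eq_rightFracDeriv_comp_neg, neg_neg]
  have hneg : ∀ φ : ℝ → ℝ, ContDiff ℝ ∞ φ → HasCompactSupport φ →
      ContDiff ℝ ∞ (fun x => φ (-x)) ∧ HasCompactSupport (fun x => φ (-x)) := fun φ h1 h2 =>
    ⟨h1.comp contDiff_neg, h2.comp_homeomorph (Homeomorph.neg ℝ)⟩
  constructor
  · intro h
    refine ⟨h.integrable.comp_neg, hv.comp_neg.locallyIntegrable, fun φ h1 h2 => ?_⟩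
    obtain ⟨h3, h4⟩ := hneg φ h1 h2
    have := h.integral_eq _ h3 h4
    rw [← key, ← key2] at this
    simpa using this
  · intro h
    refine ⟨by simpa using h.integrable.comp_neg, hv.locallyIntegrable, fun φ h1 h2 => ?_⟩
    obtain ⟨h3, h4⟩ := hneg φ h1 h2
    rw [← key, ← key2]
    exact h.integral_eq _ h3 h4

theorem ae_comp_neg {p : ℝ → Prop} (h : ∀ᵐ x, p x) : ∀ᵐ x, p (-x) :=
  (Measure.measurePreserving_neg (volume : Measure ℝ)).quasiMeasurePreserving.ae h

theorem mainTheorem2 (α : ℝ) (hα0 : 0 < α) (hα1 : α < 1) (u v : ℝ → ℝ)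
    (hu : MeasureTheory.Integrable u MeasureTheory.volume)
    (hv : MeasureTheory.Integrable v MeasureTheory.volume) :
    ((∀ᵐ x ∂(MeasureTheory.volume : MeasureTheory.Measure ℝ), u x = leftFracInt α v x) →
        IsLeftWeakFracDeriv α u v) ∧
    ((∀ᵐ x ∂(MeasureTheory.volume : MeasureTheory.Measure ℝ), u x = rightFracInt α v x) →
        IsRightWeakFracDeriv α u v) ∧
    (TendsToZeroAEAtInfinity u → IsLeftWeakFracDeriv α u v →
        ∀ᵐ x ∂(MeasureTheory.volume : MeasureTheory.Measure ℝ),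
          MeasureTheory.IntegrableOn (fun y => v y / (x - y) ^ (1 - α)) (Set.Iio x)
            MeasureTheory.volume ∧
          u x = leftFracInt α v x) ∧
    (TendsToZeroAEAtInfinity u → IsRightWeakFracDeriv α u v →
        ∀ᵐ x ∂(MeasureTheory.volume : MeasureTheory.Measure ℝ),
          MeasureTheory.IntegrableOn (fun y => v y / (y - x) ^ (1 - α)) (Set.Ioi x)
            MeasureTheory.volume ∧
          u x = rightFracInt α v x) := by

  refine ⟨isLeftWeakFracDeriv_of_ae_eq hα0 hα1 hu hv, fun h => ?_, fun _ h => ?_, fun _ h => ?_⟩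
  · rw [isRightWeakFracDeriv_iff α hv]
    refine isLeftWeakFracDeriv_of_ae_eq hα0 hα1 hu.comp_neg hv.comp_neg ?_
    filter_upwards [ae_comp_neg h] with x hx
    rw [hx, rightFracInt_eq_leftFracInt_comp_neg, neg_neg]
  · exact (ae_integrableOn_div_rpow hα0 hα1.le hv).and (h.ae_eq_leftFracInt hα0 hα1 hv)
  · have h' := ((isRightWeakFracDeriv_iff α hv).1 h).ae_eq_leftFracInt hα0 hα1 hv.comp_neg
    filter_upwards [ae_comp_neg h', ae_comp_neg (ae_integrableOn_div_rpow hα0 hα1.le hv.comp_neg)]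
      with x hx hx'
    rw [neg_neg] at hx
    refine ⟨?_, by rw [hx, rightFracInt_eq_leftFracInt_comp_neg]⟩
    have hi := ((Measure.measurePreserving_neg (volume : Measure ℝ)).integrableOn_comp_preimage
      (Homeomorph.neg ℝ).measurableEmbedding).2 hx'
    simpa [Function.comp_def, sub_eq_add_neg, add_comm] using hi
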